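/- Let $n\ge 4$ be an integer and $\varepsilon\in\{+1,-1\}$. Let $\hat Q_3(1,-1,n,\varepsilon)$ be the closure of the three-strand braid $(\sigma_1\sigma_2^{-1})^n(\sigma_1\sigma_2)^{3\varepsilon}$ (a knot exactly when $3\nmid n$). Put $[3]_q=q^2+1+q^{-2}$, $[2]_q=q+q^{-1}$, $[N+j]_q=\dfrac{Aq^{j}-A^{-1}q^{-j}}{q-q^{-1}}$. Define the un-normalized HOMFLY-PT polynomial of the closure of a three-strand braid $\beta$ by $$\mathcal H^*_{[1]}(q,A)=\sum_{\Xi\in\{[3],[1,1,1],[2,1]\}}S^*_\Xi\,\mathrm{Tr}\,\rho_\Xi(\beta),$$ with quantum dimensions $S^*_{[3]}=\frac{[N]_q[N+1]_q[N+2]_q}{[2]_q[3]_q}$, $S^*_{[1,1,1]}=\frac{[N]_q[N-1]_q[N-2]_q}{[2]_q[3]_q}$, $S^*_{[2,1]}=\frac{[N]_q[N+1]_q[N-1]_q}{[3]_q}$, where $\rho_{[3]}(\sigma_i)=q/A$, $\rho_{[1,1,1]}(\sigma_i)=-1/(qA)$ for $i=1,2$, and $\rho_{[2,1]}(\sigma_1)=A^{-1}\mathrm{diag}(q,-q^{-1})$,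 $\rho_{[2,1]}(\sigma_2)=U\rho_{[2,1]}(\sigma_1)U^{T}$ with $U=\frac1{[2]_q}\begin{pmatrix}1&\sqrt{[3]_q}\\-\sqrt{[3]_q}&1\end{pmatrix}$. Then there is a unique family of integers $\hat{\mathbf N}^{\varepsilon}_{[1],m,k}$ ($m,k\in\mathbb Z$, almost all zero), the refined BPS integers of $\hat Q_3(1,-1,n,\varepsilon)$ in the representation $[1]$, with $$\mathcal H^{*}_{[1]}(q,A)=\sum_{m,k}\hat{\mathbf N}^{\varepsilon}_{[1],m,k}\,A^m\,(q-q^{-1})^{2k-1};$$ if $3\nmid n$, only indices $k\ge 0$ occur. For $0\le k\le n$, $$\hat{\mathbf N}^{-1}_{[1],5,k-1}=G_{n,k},\quad \hat{\mathbf N}^{-1}_{[1],7,k-1}=F_{n,k},\quad \hat{\mathbf N}^{+1}_{[1],-5,k-1}=-G_{n,k},\quad \hat{\mathbf N}^{+1}_{[1],-7,k-1}=-F_{n,k},$$ where, with $\delta$ the Kronecker delta and ${}_2F_1$ the hypergeometric function, $$F_{n,k}=\frac{2(-1)^{n-1}}{(2k)!}\prod_{i=0}^{k-1}(n-i)(n+i)\;{}_2F_1\!\left(k-n,\,k+n;\,\tfrac{2k+1}{2};\,\tfrac14\right)-\left(\delta_{k,0}+3\delta_{k,1}+\delta_{k,2}\right),$$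 $$G_{n,k}=\frac{2(-1)^{n}}{(2k)!}\prod_{i=0}^{k-1}(n-i)(n+i)\;{}_2F_1\!\left(k-n,\,k+n;\,\tfrac{2k+1}{2};\,\tfrac14\right)+\left(\delta_{k,0}+6\delta_{k,1}+5\delta_{k,2}+\delta_{k,3}\right).$$ -/

import Mathlib

namespace HybridWeaving

noncomputable section

/-! ### Three-strand braids -/

/-- The braid relation `σ₁ σ₂ σ₁ = σ₂ σ₁ σ₂`, as a set of relators; `σ₁`, `σ₂` are the
generators with index `0`, `1`. -/
def braidRels : Set (FreeGroup (Fin 2)) :=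
  {FreeGroup.of 0 * FreeGroup.of 1 * FreeGroup.of 0 *
    (FreeGroup.of 1 * FreeGroup.of 0 * FreeGroup.of 1)⁻¹}

/-- Artin's braid group on three strands. -/
abbrev Braid3 : Type := PresentedGroup braidRels

/-- The generator `σ₁`. -/
def sigma1 : Braid3 := PresentedGroup.of 0

/-- The generator `σ₂`. -/
def sigma2 : Braid3 := PresentedGroup.of 1

/-- The braid `(σ₁ ^ m₁ σ₂ ^ (-m₂)) ^ n (σ₁ σ₂) ^ (3 ℓ)`, whose closure is the twisted generalized
hybrid weaving knot (or link) with parameters `m₁, -m₂, n, ℓ`. -/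
def Qhat (m₁ m₂ n : ℕ) (l : ℤ) : Braid3 :=
  (sigma1 ^ m₁ * sigma2 ^ (-(m₂ : ℤ))) ^ n * (sigma1 * sigma2) ^ (3 * l)

/-- A pair of elements of a group satisfying the braid relation gives a representation of the
three-strand braid group. -/
def braidRep {G : Type*} [Group G] (a b : G) (h : a * b * a = b * a * b) : Braid3 →* G :=
  PresentedGroup.toGroup (f := ![a, b]) (rels := braidRels) (by
    intro r hr
    rw [braidRels, Set.mem_singleton_iff] at hr
    subst hr
    simpa using mul_inv_eq_one.mpr h)

/-! ### The blocks of the braiding matrices for `[1]⊗[1]⊗[1] = [3] ⊕ [1,1,1] ⊕ 2 [2,1]` -/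

/-- The quantum number `[2]_q`. -/
def two_q (q : ℝ) : ℝ := q + q⁻¹

/-- The quantum number `[3]_q`. -/
def three_q (q : ℝ) : ℝ := q ^ 2 + 1 + q⁻¹ ^ 2

/-- The quantum number `[N + j]_q`, with `q ^ N` replaced by the variable `A`. -/
def shifted_q (q A : ℝ) (j : ℤ) : ℝ := (A * q ^ j - A⁻¹ * q ^ (-j)) / (q - q⁻¹)

/-- The Racah matrix in the multiplicity space of `[2,1]`. -/
def racah (q : ℝ) : Matrix (Fin 2) (Fin 2) ℝ :=
  !![1 / two_q q, √(three_q q) / two_q q; -(√(three_q q) / two_q q), 1 / two_q q]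

/-- The braiding matrix of `σ₁` in the multiplicity space of `[2,1]`. -/
def R1 (q A : ℝ) : Matrix (Fin 2) (Fin 2) ℝ := !![q / A, 0; 0, -(1 / (A * q))]

/-- The braiding matrix of `σ₂` in the multiplicity space of `[2,1]`. -/
def R2 (q A : ℝ) : Matrix (Fin 2) (Fin 2) ℝ := racah q * R1 q A * (racah q).transpose

theorem two_q_ne_zero {q : ℝ} (hq : 0 < q) : two_q q ≠ 0 := by
  unfold two_q; positivity

theorem det_R1_ne_zero {q A : ℝ} (hq : 0 < q) (hA : A ≠ 0) : (R1 q A).det ≠ 0 := by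
  have := hq.ne'
  simp [R1, Matrix.det_fin_two, hA, this]

theorem det_racah {q : ℝ} (hq : 0 < q) : (racah q).det = 1 := by
  have h2 := two_q_ne_zero hq
  have h3 : √(three_q q) ^ 2 = three_q q := Real.sq_sqrt (by unfold three_q; positivity)
  have : (racah q).det = (1 + √(three_q q) ^ 2) / two_q q ^ 2 := by
    simp only [racah, Matrix.det_fin_two_of]; field_simp; ring
  rw [this, h3, div_eq_one_iff_eq (pow_ne_zero 2 h2)]
  unfold two_q three_q
  field_simp
  ring

theorem det_R2_ne_zero {q A : ℝ} (hq : 0 < q) (hA : A ≠ 0) : (R2 q A).det ≠ 0 := by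
  rw [R2, Matrix.det_mul, Matrix.det_mul, Matrix.det_transpose, det_racah hq]
  simpa using det_R1_ne_zero hq hA

theorem R2_eq {q A : ℝ} (hq : 0 < q) (hA : A ≠ 0) :
    R2 q A = !![-(q⁻¹ ^ 2 / (A * two_q q)), -(√(three_q q) / (A * two_q q));
      -(√(three_q q) / (A * two_q q)), q ^ 2 / (A * two_q q)] := by
  have h2 := two_q_ne_zero hq
  have hq' := hq.ne'
  have h3 : √(three_q q) ^ 2 = three_q q := Real.sq_sqrt (by unfold three_q; positivity)
  have h5 : q ^ 2 + 1 ≠ 0 := by positivity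
  ext i j
  fin_cases i <;> fin_cases j <;>
    simp [R2, racah, R1, Matrix.mul_apply, Fin.sum_univ_two] <;>
    field_simp <;> (try rw [h3]) <;> unfold two_q <;> (try unfold three_q) <;> field_simp <;> ring

theorem R_braid {q A : ℝ} (hq : 0 < q) (hA : A ≠ 0) :
    R1 q A * R2 q A * R1 q A = R2 q A * R1 q A * R2 q A := by
  have hq' := hq.ne'
  have h3 : √(three_q q) ^ 2 = three_q q := Real.sq_sqrt (by unfold three_q; positivity)
  have h5 : q ^ 2 + 1 ≠ 0 := by positivity
  rw [R2_eq hq hA]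
  generalize √(three_q q) = s at h3
  unfold three_q at h3
  unfold two_q
  field_simp at h3
  ext i j
  fin_cases i <;> fin_cases j <;>
    simp [R1, Matrix.mul_apply, Fin.sum_univ_two] <;>
    field_simp
  all_goals first
    | linear_combination h3
    | linear_combination -h3
    | ring1

/-- The action of three-strand braids on the multiplicity space of `[3]`: both generators act by
`q / A`. -/
def rep3 (q A : ℝ) (hq : 0 < q) (hA : A ≠ 0) : Braid3 →* ℝˣ :=
  braidRep (Units.mk0 (q / A) (div_ne_zero hq.ne' hA)) (Units.mk0 (q / A) (div_ne_zero hq.ne' hA))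
    rfl

/-- The action of three-strand braids on the multiplicity space of `[1,1,1]`: both generators act
by `-1 / (q A)`. -/
def rep111 (q A : ℝ) (hq : 0 < q) (hA : A ≠ 0) : Braid3 →* ℝˣ :=
  braidRep (Units.mk0 (-(1 / (A * q))) (by have := hq.ne'; simp [hA, this]))
    (Units.mk0 (-(1 / (A * q))) (by have := hq.ne'; simp [hA, this])) rfl

/-- The action of three-strand braids on the two-dimensional multiplicity space of `[2,1]`. -/
def rep21 (q A : ℝ) (hq : 0 < q) (hA : A ≠ 0) : Braid3 →* GL (Fin 2) ℝ :=
  braidRep (Matrix.GeneralLinearGroup.mkOfDetNeZero (R1 q A) (det_R1_ne_zero hq hA))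
    (Matrix.GeneralLinearGroup.mkOfDetNeZero (R2 q A) (det_R2_ne_zero hq hA))
    (Units.ext (R_braid hq hA))

/-! ### Quantum dimensions and the HOMFLY-PT polynomial -/

/-- The quantum dimension of `[3]`. -/
def S3 (q A : ℝ) : ℝ :=
  shifted_q q A 0 * shifted_q q A 1 * shifted_q q A 2 / (two_q q * three_q q)

/-- The quantum dimension of `[1,1,1]`. -/
def S111 (q A : ℝ) : ℝ :=
  shifted_q q A 0 * shifted_q q A (-1) * shifted_q q A (-2) / (two_q q * three_q q)

/-- The quantum dimension of `[2,1]`. -/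
def S21 (q A : ℝ) : ℝ :=
  shifted_q q A 0 * shifted_q q A 1 * shifted_q q A (-1) / three_q q

/-- The un-normalized HOMFLY-PT polynomial `H*_[1]` (the unknot has the value `[N]_q`, that is
`(A - A⁻¹) / (q - q⁻¹)`) of the closure of a three-strand braid: the sum over the irreducible
components of `[1]⊗[1]⊗[1]` of the quantum dimension times the trace of the braid on the
multiplicity space. -/
def homflyStar (b : Braid3) (q A : ℝ) (hq : 0 < q) (hA : A ≠ 0) : ℝ :=
  S3 q A * (rep3 q A hq hA b : ℝ) + S111 q A * (rep111 q A hq hA b : ℝ) +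
    S21 q A * Matrix.trace (rep21 q A hq hA b : Matrix (Fin 2) (Fin 2) ℝ)

/-! ### Refined BPS integers in the fundamental representation -/

/-- The reformulated invariant `f_[1]`, which is the un-normalized polynomial `H*_[1]`. -/
def reformulated (b : Braid3) (q A : ℝ) (hq : 0 < q) (hA : A ≠ 0) : ℝ :=
  homflyStar b q A hq hA

/-- The coefficient `C_{[1][1]}`, that is
`(q - q⁻¹)⁻¹ * ∑_Δ z_Δ⁻¹ ψ_[1](Δ) ψ_[1](Δ) ∏_i (q ^ ξ_i - q ^ (-ξ_i))`: the only `Δ` is the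
partition with one part `1`, with `z_Δ = 1` and both characters equal to `1`. -/
def cBox (q : ℝ) : ℝ := (q - q⁻¹)⁻¹ * ((1 : ℝ)⁻¹ * 1 * 1 * (q - q⁻¹))

/-- `N` is the family of refined integers of the closure of `b` in the representation `[1]`:
`N (m, k)` are integers, almost all zero, with
`f_[1] = ∑ C_{[1][1]} N (m, k) A ^ m (q - q⁻¹) ^ (2 k - 1)` identically in `q` and `A`. For a knot
only `k ≥ 0` can occur; the index `k` ranges over all integers to admit links with several
components as well. -/
def IsRefinedFamily (b : Braid3) (N : ℤ × ℤ →₀ ℤ) : Prop :=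
  ∀ (q A : ℝ) (hq : 0 < q) (hA : A ≠ 0), q ≠ 1 →
    reformulated b q A hq hA =
      N.sum fun p c => cBox q * (c : ℝ) * A ^ p.1 * (q - q⁻¹) ^ (2 * p.2 - 1)

/-! ### The closed formulas -/

/-- The common main term
`2 / (2k)! * ∏_{i<k} (n - i) (n + i) * ₂F₁(k - n, k + n; (2k+1)/2; 1/4)`. -/
def mainTerm (n k : ℕ) : ℝ :=
  2 / ((2 * k).factorial : ℝ) * (∏ i ∈ Finset.range k, ((n : ℝ) - i) * ((n : ℝ) + i)) *
    ordinaryHypergeometric ((k : ℝ) - n) ((k : ℝ) + n) ((2 * (k : ℝ) + 1) / 2) (1 / 4 : ℝ)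

/-- The Kronecker delta. -/
def delta (i j : ℕ) : ℝ := if i = j then 1 else 0

/-- The numbers `F_{n,k}`. -/
def F (n k : ℕ) : ℝ :=
  (-1) ^ (n - 1) * mainTerm n k - (delta k 0 + 3 * delta k 1 + delta k 2)

/-- The numbers `G_{n,k}`. -/
def G (n k : ℕ) : ℝ :=
  (-1) ^ n * mainTerm n k + (delta k 0 + 6 * delta k 1 + 5 * delta k 2 + delta k 3)

end

end HybridWeaving

/-! Put `z = q - q⁻¹` and `w = z ^ 2`, so that `[3]_q = w + 3`. The full twist `(σ₁σ₂)³` acts on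
every block by a scalar. On `[3]` and `[1,1,1]` the factor `σ₁σ₂⁻¹` acts trivially; on `[2,1]` it is
a matrix of determinant `1` and trace `-1 - w`, so its `n`-th power has trace `V(w) = C_n(-1 - w)`,
with `C_n` the rescaled Chebyshev polynomial (`trace_pow_eq_eval_tracePoly`).

For the negative twist, `z³ H*` is therefore a combination of `A⁹, A⁷, A⁵, A³`
(`homflyStar_Qhat_neg_one`). The coefficients of `A⁷` and `A⁵` are `∓V` plus explicit polynomials;
the other two involve `(w + 1 + V) / (w + 3)`, a polynomial over `ℤ` because `V(-3) = C_n(2) = 2`.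
The positive twist follows from `(q, A) ↦ (q⁻¹, A⁻¹)`, and uniqueness from the independence of
characters.

It remains to expand `V(w) = (-1)^n C_n(1 + w)`. The Taylor coefficients of `C_n` at `2` are
explicit products, and shifting the centre from `2` to `1` turns them into `₂F₁` at `1/4`
(`mainTerm_eq_coeff`). -/

open Polynomial

namespace HybridWeaving

/-! ### Chebyshev polynomials and the hypergeometric main term -/

/-- The Taylor coefficients at `2` of the rescaled Chebyshev polynomial `C_n`, in terms of the
derivatives at `1` of `T_n`. -/
theorem coeff_taylor_two_chebyshevC (n : ℤ) (j : ℕ) :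
    (taylor 2 (Chebyshev.C ℝ n)).coeff j * (2 ^ j * j.factorial) =
      2 * (derivative^[j] (Chebyshev.T ℝ n)).eval 1 := by
  -- This is `C_n(2 + 2x) = 2 T_n(1 + x)`, to be compared coefficientwise.
  have h : (taylor 2 (Chebyshev.C ℝ n)).comp (C 2 * X) = taylor 1 (2 * Chebyshev.T ℝ n) := by
    rw [← Chebyshev.C_comp_two_mul_X, taylor_apply, taylor_apply, comp_assoc, comp_assoc]
    congr 1
    simp only [add_comp, X_comp, mul_comp, ofNat_comp, map_ofNat, map_one]
    ring
  have h' := congrArg (fun p => coeff p j) h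
  simp only [comp_C_mul_X_coeff, taylor_mul, taylor_coeff] at h'
  have h2 : taylor (1 : ℝ) (2 : ℝ[X]) = C 2 := by
    simpa only [map_ofNat] using taylor_C (1 : ℝ) (2 : ℝ)
  rw [h2, coeff_C_mul, taylor_coeff] at h'
  rw [← factorial_smul_hasseDeriv, LinearMap.smul_apply, eval_smul, nsmul_eq_mul, taylor_coeff]
  linear_combination (j.factorial : ℝ) * h'

theorem natDegree_chebyshevC (n : ℕ) : (Chebyshev.C ℝ n).natDegree = n := by
  have h := congrArg natDegree (Chebyshev.C_comp_two_mul_X ℝ n)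
  have h2 : (2 : ℝ[X]) = C 2 := (map_ofNat C 2).symm
  rw [natDegree_comp, h2, natDegree_C_mul (by norm_num), natDegree_C_mul (by norm_num),
    Chebyshev.natDegree_T, natDegree_X, mul_one] at h
  simpa using h

/-- The coefficients of `C_n (1 + w)` in terms of the Taylor coefficients of `C_n` at `2`. -/
theorem coeff_taylor_one_chebyshevC (n k : ℕ) :
    (taylor 1 (Chebyshev.C ℝ n)).coeff k =
      ∑ s ∈ Finset.range (n - k + 1),
        ((s + k).choose k : ℝ) * (taylor 2 (Chebyshev.C ℝ n)).coeff (s + k) * (-1) ^ s := by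
  have h : taylor 1 (Chebyshev.C ℝ n) = taylor (-1) (taylor 2 (Chebyshev.C ℝ n)) := by
    rw [taylor_taylor]; norm_num
  rw [h, taylor_coeff, eval_eq_sum_range' (n := n - k + 1)]
  · simp only [hasseDeriv_coeff]
  · have := natDegree_hasseDeriv_le (taylor 2 (Chebyshev.C ℝ n)) k
    rw [natDegree_taylor, natDegree_chebyshevC] at this
    omega

/-- The Chebyshev differential equation at `1` gives `(2k + 1) T_n^(k+1)(1) = (n² - k²) T_n^(k)(1)`,
and the product obeys the matching recurrence. -/
theorem two_mul_prod_div_factorial (n k : ℕ) :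
    2 / ((2 * k).factorial : ℝ) * (∏ i ∈ Finset.range k, ((n : ℝ) - i) * ((n : ℝ) + i)) =
      (taylor 2 (Chebyshev.C ℝ n)).coeff k := by
  have hD := coeff_taylor_two_chebyshevC n k
  have hE : (∏ i ∈ Finset.range k, ((n : ℝ) - i) * ((n : ℝ) + i)) * (2 ^ k * k.factorial) =
      (2 * k).factorial * (derivative^[k] (Chebyshev.T ℝ n)).eval 1 := by
    clear hD
    induction k with
    | zero => simp
    | succ k ih =>
      have h := Chebyshev.iterate_derivative_T_eval_one_recurrence (R := ℝ) n k
      rw [Finset.prod_range_succ, show 2 * (k + 1) = 2 * k + 1 + 1 by ring, Nat.factorial_succ,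
        Nat.factorial_succ, Nat.factorial_succ]
      push_cast at h ⊢
      linear_combination (((n : ℝ) - k) * (n + k) * 2 * (k + 1)) * ih -
        (2 * (k : ℝ) + 1 + 1) * (2 * k).factorial * h
  have h1 : (2 : ℝ) ^ k * k.factorial ≠ 0 := by positivity
  have h2 : ((2 * k).factorial : ℝ) ≠ 0 := by positivity
  rw [div_mul_eq_mul_div, div_eq_iff h2]
  apply mul_right_cancel₀ h1
  linear_combination 2 * hE - ((2 * k).factorial : ℝ) * hD

/-- Both sides agree at `s = 0` and have the same ratio of consecutive terms in `s`, by the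
recurrence for the Taylor coefficients at `2`. -/
theorem coeff_taylor_two_mul_hypergeometric_term (n k s : ℕ) :
    (taylor 2 (Chebyshev.C ℝ n)).coeff k *
      (((s.factorial : ℝ)⁻¹ * (ascPochhammer ℝ s).eval ((k : ℝ) - n) *
        (ascPochhammer ℝ s).eval ((k : ℝ) + n) *
        ((ascPochhammer ℝ s).eval ((2 * (k : ℝ) + 1) / 2))⁻¹) * (1 / 4) ^ s) =
      ((s + k).choose k : ℝ) * (taylor 2 (Chebyshev.C ℝ n)).coeff (s + k) * (-1) ^ s := by
  induction s with
  | zero => simp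
  | succ s ih =>
    have h1 := coeff_taylor_two_chebyshevC n (s + k)
    have h2 := coeff_taylor_two_chebyshevC n (s + k + 1)
    have h := Chebyshev.iterate_derivative_T_eval_one_recurrence (R := ℝ) n (s + k)
    set b := (taylor 2 (Chebyshev.C ℝ n)).coeff (s + k)
    set b' := (taylor 2 (Chebyshev.C ℝ n)).coeff (s + k + 1)
    have hb : b' * (2 * (s + k) + 1) * (2 * (s + k + 1)) = ((n : ℝ) ^ 2 - (s + k) ^ 2) * b := by
      rw [Nat.factorial_succ] at h2
      push_cast at h h2
      have hp : (2 : ℝ) ^ (s + k) * (s + k).factorial ≠ 0 := by positivity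
      apply mul_right_cancel₀ hp
      linear_combination (2 * ((s : ℝ) + k) + 1) * h2 - ((n : ℝ) ^ 2 - (s + k) ^ 2) * h1 + 2 * h
    have hc : ((s + k + 1).choose k : ℝ) * (s + 1) = (s + k).choose k * (s + k + 1) := by
      have := Nat.choose_mul_succ_eq (s + k) k
      rw [show s + k + 1 - k = s + 1 by omega] at this
      exact_mod_cast this.symm
    rw [ascPochhammer_succ_eval, ascPochhammer_succ_eval, ascPochhammer_succ_eval,
      Nat.factorial_succ, show s + 1 + k = s + k + 1 by ring]
    change _ = ((s + k + 1).choose k : ℝ) * b' * _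
    have e1 : (2 * (k : ℝ) + 1) / 2 + s ≠ 0 := by positivity
    have e2 : (s : ℝ) + 1 ≠ 0 := by positivity
    have e4 : 2 * ((s : ℝ) + k) + 1 ≠ 0 := by positivity
    have hb' : b' = ((n : ℝ) ^ 2 - (s + k) ^ 2) * b / ((2 * (s + k) + 1) * (2 * (s + k + 1))) := by
      rw [eq_div_iff (by positivity)]; linear_combination hb
    have hc' : ((s + k + 1).choose k : ℝ) = (s + k).choose k * (s + k + 1) / (s + 1) := by
      rw [eq_div_iff e2, hc]
    rw [hb', hc', mul_inv]
    push_cast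
    rw [mul_inv]
    have key : ((s + k).choose k * (s + k + 1) / (s + 1) *
        (((n : ℝ) ^ 2 - (s + k) ^ 2) * b / ((2 * (s + k) + 1) * (2 * (s + k + 1)))) *
          (-1) ^ (s + 1)) =
        ((s + k).choose k * b * (-1) ^ s) * ((((k : ℝ) - n + s) * (k + n + s)) /
          ((s + 1) * ((2 * k + 1) / 2 + s) * 4)) := by
      field_simp
      ring
    rw [key, ← ih, pow_succ]
    field_simp

/-- The main term is a coefficient of the rescaled Chebyshev polynomial `C_n (1 + w)`. -/
theorem mainTerm_eq_coeff {n k : ℕ} (hk : k ≤ n) :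
    mainTerm n k = (taylor 1 (Chebyshev.C ℝ n)).coeff k := by
  rw [coeff_taylor_one_chebyshevC, mainTerm, two_mul_prod_div_factorial,
    ordinaryHypergeometric, ordinaryHypergeometric_sum_eq,
    tsum_eq_sum (s := Finset.range (n - k + 1)), Finset.mul_sum]
  · exact Finset.sum_congr rfl fun s _ => coeff_taylor_two_mul_hypergeometric_term n k s
  · intro s hs
    rw [Finset.mem_range, not_lt] at hs
    -- Since `k ≤ n`, the parameter `k - n` is a nonpositive integer and the series stops at `s = n
    -- - k`.
    have : (ascPochhammer ℝ s).eval ((k : ℝ) - n) = 0 := by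
      rw [← neg_sub, ← Nat.cast_sub hk]
      exact ascPochhammer_eval_neg_coe_nat_of_lt (by omega)
    simp [this]

/-- `C_n (-1 - w)`, the trace of the `n`-th power of a matrix in `SL₂` of trace `-1 - w`. -/
noncomputable def tracePoly (n : ℕ) : ℤ[X] := (Chebyshev.C ℤ n).comp (-1 - X)

theorem tracePoly_zero : tracePoly 0 = 2 := by simp [tracePoly]

theorem tracePoly_one : tracePoly 1 = -1 - X := by simp [tracePoly]

theorem tracePoly_add_two (n : ℕ) :
    tracePoly (n + 2) = (-1 - X) * tracePoly (n + 1) - tracePoly n := by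
  simp only [tracePoly, Nat.cast_add, Nat.cast_ofNat, Nat.cast_one, Chebyshev.C_add_two, sub_comp,
    mul_comp, X_comp]

/-- `C_n` has the parity of `n`; this is the source of the signs in `F` and `G`. -/
theorem map_tracePoly (n : ℕ) :
    (tracePoly n).map (Int.castRingHom ℝ) = (-1) ^ n * taylor 1 (Chebyshev.C ℝ n) := by
  induction n using Nat.twoStepInduction with
  | zero => simp [tracePoly_zero, taylor_apply]
  | one => simp [tracePoly_one]; ring
  | more n h1 h2 =>
    rw [tracePoly_add_two, Polynomial.map_sub, Polynomial.map_mul, h1, h2]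
    push_cast
    rw [Chebyshev.C_add_two, map_sub, taylor_mul]
    simp
    ring

theorem coeff_tracePoly {n k : ℕ} (hk : k ≤ n) :
    ((tracePoly n).coeff k : ℝ) = (-1) ^ n * mainTerm n k := by
  have h := congrArg (fun p => coeff p k) (map_tracePoly n)
  simp only [coeff_map, eq_intCast] at h
  rw [h, mainTerm_eq_coeff hk, show ((-1 : ℝ[X]) ^ n) = C ((-1) ^ n) by simp, coeff_C_mul]

theorem eval_tracePoly_neg_three (n : ℕ) : (tracePoly n).eval (-3) = 2 := by
  simp [tracePoly, eval_comp]

/-- At `w = 0` the recurrence is `V_{n+2} = -V_{n+1} - V_n`, of period three with values `2, -1,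
-1`. -/
theorem eval_tracePoly_zero {n : ℕ} (hn : ¬ 3 ∣ n) : (tracePoly n).eval 0 = -1 := by
  have hper (m : ℕ) : (tracePoly (m + 3)).eval 0 = (tracePoly m).eval 0 := by
    rw [show m + 3 = m + 1 + 2 by ring, tracePoly_add_two, tracePoly_add_two]
    simp
  have hall (m : ℕ) : (tracePoly (3 * m + 1)).eval 0 = -1 ∧ (tracePoly (3 * m + 2)).eval 0 = -1 := by
    induction m with
    | zero =>
      have := tracePoly_add_two 0
      simp_all [tracePoly_one, tracePoly_zero]
    | succ m ih =>
      exact ⟨(hper (3 * m + 1)).trans ih.1, (hper (3 * m + 2)).trans ih.2⟩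
  obtain h | h : n = 3 * (n / 3) + 1 ∨ n = 3 * (n / 3) + 2 := by omega
  · rw [h]; exact (hall _).1
  · rw [h]; exact (hall _).2

/-- The Cayley-Hamilton theorem for matrices of size two. -/
theorem sq_eq_trace_smul_sub_det_smul_one (M : Matrix (Fin 2) (Fin 2) ℝ) :
    M ^ 2 = M.trace • M - M.det • 1 := by
  ext i j
  fin_cases i <;> fin_cases j <;>
    simp [pow_two, Matrix.mul_apply, Fin.sum_univ_two, Matrix.trace_fin_two,
      Matrix.det_fin_two] <;> ring

theorem trace_pow_eq_eval_tracePoly (M : Matrix (Fin 2) (Fin 2) ℝ) (w : ℝ) (hdet : M.det = 1)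
    (htr : M.trace = -1 - w) (n : ℕ) : (M ^ n).trace = aeval w (tracePoly n) := by
  induction n using Nat.twoStepInduction with
  | zero => simp [tracePoly_zero, map_ofNat]
  | one => simp [tracePoly_one, htr]
  | more n h1 h2 =>
    have : M ^ (n + 2) = (-1 - w) • M ^ (n + 1) - M ^ n := by
      rw [pow_add, sq_eq_trace_smul_sub_det_smul_one, htr, hdet, mul_sub, mul_smul_comm, one_smul, mul_one, pow_succ]
    rw [this, tracePoly_add_two, Matrix.trace_sub, Matrix.trace_smul, h1, h2]
    simp

end HybridWeaving

namespace HybridWeaving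

/-! ### Evaluation of the HOMFLY-PT polynomial -/

section braidRep

variable {G : Type*} [Group G] (a b : G) (h : a * b * a = b * a * b)

theorem braidRep_sigma1 : braidRep a b h sigma1 = a := by
  simp [braidRep, sigma1]

theorem braidRep_sigma2 : braidRep a b h sigma2 = b := by
  simp [braidRep, sigma2]

theorem braidRep_Qhat_one_one (n : ℕ) (l : ℤ) :
    braidRep a b h (Qhat 1 1 n l) = (a * b⁻¹) ^ n * ((a * b) ^ 3) ^ l := by
  rw [Qhat, map_mul, map_pow, map_mul, map_pow, map_zpow, map_zpow, map_mul, braidRep_sigma1,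
    braidRep_sigma2, zpow_mul]
  simp

end braidRep

section evaluation

variable {q A : ℝ} (hq : 0 < q) (hA : A ≠ 0)

theorem rep3_Qhat_one_one (n : ℕ) (l : ℤ) :
    (rep3 q A hq hA (Qhat 1 1 n l) : ℝ) = ((q / A) ^ 6) ^ l := by
  rw [rep3, braidRep_Qhat_one_one, mul_inv_cancel, one_pow, one_mul, Units.val_zpow_eq_zpow_val]
  simp only [Units.val_pow_eq_pow_val, Units.val_mul, Units.val_mk0]
  congr 1
  ring

theorem rep111_Qhat_one_one (n : ℕ) (l : ℤ) :
    (rep111 q A hq hA (Qhat 1 1 n l) : ℝ) = ((A * q) ^ 6)⁻¹ ^ l := by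
  rw [rep111, braidRep_Qhat_one_one, mul_inv_cancel, one_pow, one_mul,
    Units.val_zpow_eq_zpow_val]
  simp only [Units.val_pow_eq_pow_val, Units.val_mul, Units.val_mk0]
  congr 1
  ring

/-- With `t = -A⁻²`, the product has trace `t` and determinant `t²`, and `x² - t x + t²` divides `x³
+ t³`. -/
theorem R1_mul_R2_pow_three (hq : 0 < q) (hA : A ≠ 0) :
    (R1 q A * R2 q A) ^ 3 = (A ^ 6)⁻¹ • (1 : Matrix (Fin 2) (Fin 2) ℝ) := by
  have hq' := hq.ne'
  have h5 : q ^ 2 + 1 ≠ 0 := by positivity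
  have htr : (R1 q A * R2 q A).trace = -(A ^ 2)⁻¹ := by
    rw [R2_eq hq hA, two_q]
    simp [R1, Matrix.trace_fin_two]
    field_simp
    ring
  have hdet : (R1 q A * R2 q A).det = (A ^ 4)⁻¹ := by
    rw [R2, Matrix.det_mul, Matrix.det_mul, Matrix.det_mul, Matrix.det_transpose, det_racah hq]
    simp [R1]
    field_simp
  generalize R1 q A * R2 q A = M at htr hdet
  have hM := sq_eq_trace_smul_sub_det_smul_one M
  rw [htr, hdet] at hM
  rw [pow_succ, hM, sub_mul, smul_mul_assoc, ← pow_two, hM, smul_mul_assoc, one_mul, smul_sub,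
    smul_smul, smul_smul]
  have e1 : -(A ^ 2)⁻¹ * -(A ^ 2)⁻¹ = (A ^ 4)⁻¹ := by field_simp
  have e2 : -(A ^ 2)⁻¹ * (A ^ 4)⁻¹ = -(A ^ 6)⁻¹ := by field_simp
  rw [e1, e2, neg_smul]
  abel

/-- The factors `A⁻¹` cancel, so on `[2,1]` only the full twist contributes powers of `A`. -/
theorem R1_mul_R2_inv (hq : 0 < q) (hA : A ≠ 0) :
    (R1 q A * (R2 q A)⁻¹).det = 1 ∧
      (R1 q A * (R2 q A)⁻¹).trace = -1 - (q - q⁻¹) ^ 2 := by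
  have hq' := hq.ne'
  have h5 : q ^ 2 + 1 ≠ 0 := by positivity
  have hdet : (R2 q A).det = -(A ^ 2)⁻¹ := by
    rw [R2, Matrix.det_mul, Matrix.det_mul, Matrix.det_transpose, det_racah hq]
    simp [R1]
    field_simp
  constructor
  · rw [Matrix.det_mul, Matrix.det_nonsing_inv, hdet]
    simp [R1, Ring.inverse_eq_inv']
    field_simp
  · rw [Matrix.inv_def, hdet, R2_eq hq hA, two_q]
    simp [R1, Ring.inverse_eq_inv', Matrix.trace_fin_two, Matrix.adjugate_fin_two]
    field_simp
    ring

theorem trace_rep21_Qhat_one_one (n : ℕ) (l : ℤ) :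
    Matrix.trace (rep21 q A hq hA (Qhat 1 1 n l) : Matrix (Fin 2) (Fin 2) ℝ) =
      (A ^ 6)⁻¹ ^ l * aeval ((q - q⁻¹) ^ 2) (tracePoly n) := by
  have hA6 : (A ^ 6)⁻¹ ≠ 0 := by positivity
  have hc : (Matrix.GeneralLinearGroup.mkOfDetNeZero (R1 q A) (det_R1_ne_zero hq hA) *
      Matrix.GeneralLinearGroup.mkOfDetNeZero (R2 q A) (det_R2_ne_zero hq hA)) ^ 3 =
      Units.map (algebraMap ℝ (Matrix (Fin 2) (Fin 2) ℝ) : ℝ →* _) (Units.mk0 _ hA6) := by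
    apply Units.ext
    simpa [Matrix.GeneralLinearGroup.mkOfDetNeZero, Algebra.algebraMap_eq_smul_one] using
      R1_mul_R2_pow_three hq hA
  obtain ⟨h1, h2⟩ := R1_mul_R2_inv hq hA
  rw [rep21, braidRep_Qhat_one_one, hc, ← map_zpow, Units.val_mul, Units.coe_map,
    Units.val_zpow_eq_zpow_val, ← trace_pow_eq_eval_tracePoly _ _ h1 h2]
  rw [Units.val_pow_eq_pow_val, Units.val_mul, Matrix.coe_units_inv]
  simp [Matrix.GeneralLinearGroup.mkOfDetNeZero, Algebra.algebraMap_eq_smul_one]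

theorem homflyStar_Qhat_one_one (n : ℕ) (l : ℤ) :
    homflyStar (Qhat 1 1 n l) q A hq hA =
      S3 q A * ((q / A) ^ 6) ^ l + S111 q A * ((A * q) ^ 6)⁻¹ ^ l +
        S21 q A * ((A ^ 6)⁻¹ ^ l * aeval ((q - q⁻¹) ^ 2) (tracePoly n)) := by
  rw [homflyStar, rep3_Qhat_one_one, rep111_Qhat_one_one, trace_rep21_Qhat_one_one]

theorem shifted_q_inv (q A : ℝ) (j : ℤ) : shifted_q q⁻¹ A⁻¹ j = shifted_q q A j := by
  rw [shifted_q, shifted_q, ← neg_div_neg_eq, neg_sub, neg_sub]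
  simp [inv_zpow']

/-- The mirror symmetry `(q, A) ↦ (q⁻¹, A⁻¹)` exchanges the two signs of the full twist. -/
theorem homflyStar_Qhat_neg (n : ℕ) (l : ℤ) :
    homflyStar (Qhat 1 1 n (-l)) q A hq hA =
      homflyStar (Qhat 1 1 n l) q⁻¹ A⁻¹ (inv_pos.2 hq) (inv_ne_zero hA) := by
  have h2 : two_q q⁻¹ = two_q q := by simp [two_q, add_comm]
  have h3 : three_q q⁻¹ = three_q q := by simp only [three_q, inv_inv]; ring
  have hz : (q⁻¹ - q) ^ 2 = (q - q⁻¹) ^ 2 := by ring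
  have e1 : (q⁻¹ / A⁻¹) ^ 6 = ((q / A) ^ 6)⁻¹ := by
    rw [← inv_pow, inv_div, div_eq_mul_inv, inv_inv, div_eq_mul_inv, mul_comm]
  have e2 : ((A⁻¹ * q⁻¹) ^ 6)⁻¹ = (A * q) ^ 6 := by rw [← mul_inv, inv_pow, inv_inv]
  have e3 : (A⁻¹ ^ 6)⁻¹ = A ^ 6 := by rw [inv_pow, inv_inv]
  simp only [homflyStar_Qhat_one_one, S3, S111, S21, shifted_q_inv, h2, h3, hz, e1, e2, e3,
    zpow_neg, inv_zpow, inv_inv]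

/-- The HOMFLY-PT polynomial for a negative full twist as a polynomial in `A` and
`w = (q - q⁻¹) ^ 2`, where `a` is the exact quotient by `[3]_q = w + 3`. -/
theorem homflyStar_Qhat_neg_one (hq1 : q ≠ 1) (n : ℕ) {w a : ℝ} (hw : w = (q - q⁻¹) ^ 2)
    (ha : (w + 3) * a = w + 1 + aeval w (tracePoly n)) :
    homflyStar (Qhat 1 1 n (-1)) q A hq hA =
      (q - q⁻¹) ^ (-3 : ℤ) * (a * A ^ 9 - (aeval w (tracePoly n) + (1 + 3 * w + w ^ 2)) * A ^ 7 +
        (aeval w (tracePoly n) + (1 + 6 * w + 5 * w ^ 2 + w ^ 3)) * A ^ 5 -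
        (a + (3 * w + 4 * w ^ 2 + w ^ 3)) * A ^ 3) := by
  have hq' := hq.ne'
  have h5 : q ^ 2 + 1 ≠ 0 := by positivity
  have h6 : q ^ 2 * (q ^ 2 + 1) + 1 ≠ 0 := by positivity
  have h7 : q ^ 2 - 1 ≠ 0 := by
    intro h
    have : (q - 1) * (q + 1) = 0 := by linear_combination h
    rcases mul_eq_zero.1 this with h | h
    · exact hq1 (by linarith)
    · linarith
  -- Eliminating the trace in favour of `a` leaves a rational identity in `q`, `A`, `a` that no
  -- longer depends on `n`.
  have hv : aeval w (tracePoly n) = (w + 3) * a - w - 1 := by linear_combination -ha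
  rw [homflyStar_Qhat_one_one, ← hw, hv, hw]
  simp only [S3, S111, S21, shifted_q, two_q, three_q]
  simp only [zpow_neg, zpow_ofNat, neg_neg, neg_zero, Int.reduceNeg]
  field_simp
  ring

end evaluation

end HybridWeaving

namespace HybridWeaving

/-! ### Uniqueness of the refined family -/

/-- The character `(A, z) ↦ A ^ m * z ^ (2 k - 1)` of `ℝˣ × ℝˣ`. -/
def monomialChar (p : ℤ × ℤ) : ℝˣ × ℝˣ →* ℝ :=
  (Units.coeHom ℝ).comp
    ((zpowGroupHom p.1).comp (MonoidHom.fst ℝˣ ℝˣ) *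
      (zpowGroupHom (2 * p.2 - 1)).comp (MonoidHom.snd ℝˣ ℝˣ))

theorem monomialChar_apply (p : ℤ × ℤ) (x : ℝˣ × ℝˣ) :
    monomialChar p x = (x.1 : ℝ) ^ p.1 * (x.2 : ℝ) ^ (2 * p.2 - 1) := by
  simp [monomialChar]

theorem monomialChar_injective : Function.Injective monomialChar := by
  intro p p' h
  have h1 := DFunLike.congr_fun h (Units.mk0 2 two_ne_zero, 1)
  have h2 := DFunLike.congr_fun h (1, Units.mk0 2 two_ne_zero)
  simp only [monomialChar_apply, Units.val_mk0, Units.val_one, one_zpow, mul_one, one_mul] at h1 h2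
  have h1' := zpow_right_injective₀ (a := (2 : ℝ)) (by norm_num) (by norm_num) h1
  have h2' := zpow_right_injective₀ (a := (2 : ℝ)) (by norm_num) (by norm_num) h2
  exact Prod.ext h1' (by omega)

theorem sub_inv_ne_zero {q : ℝ} (hq : 0 < q) (hq1 : q ≠ 1) : q - q⁻¹ ≠ 0 := by
  intro h
  have h' : q * q = 1 := by
    have := mul_inv_cancel₀ hq.ne'
    rwa [← sub_eq_zero.1 h] at this
  rcases mul_self_eq_one_iff.1 h' with h | h
  · exact hq1 h
  · linarith

theorem cBox_eq_one {q : ℝ} (hq : 0 < q) (hq1 : q ≠ 1) : cBox q = 1 := by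
  simp [cBox, sub_inv_ne_zero hq hq1]

/-- The witness is the positive root of `x² - z x - 1`. Hence an identity in `q` becomes one for all
`z` in `ℝˣ`, where characters are independent. -/
theorem exists_sub_inv_eq {z : ℝ} (hz : z ≠ 0) : ∃ q : ℝ, 0 < q ∧ q ≠ 1 ∧ q - q⁻¹ = z := by
  have hs : √(z ^ 2 + 4) ^ 2 = z ^ 2 + 4 := Real.sq_sqrt (by positivity)
  have hlt : |z| < √(z ^ 2 + 4) := by
    rw [← Real.sqrt_sq_eq_abs]
    exact Real.sqrt_lt_sqrt (sq_nonneg z) (by linarith)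
  have hpos : 0 < z + √(z ^ 2 + 4) := by linarith [neg_abs_le z]
  have hq : (z + √(z ^ 2 + 4)) / 2 - ((z + √(z ^ 2 + 4)) / 2)⁻¹ = z := by
    field_simp
    linear_combination hs
  refine ⟨(z + √(z ^ 2 + 4)) / 2, by positivity, fun h => hz ?_, hq⟩
  rw [h] at hq
  simpa using hq.symm

/-- Distinct characters of `ℝˣ × ℝˣ` are linearly independent (Dedekind), so the expansion
determines its coefficients. -/
theorem IsRefinedFamily.unique {b : Braid3} {N N' : ℤ × ℤ →₀ ℤ} (h : IsRefinedFamily b N)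
    (h' : IsRefinedFamily b N') : N = N' := by
  have hli := (linearIndependent_monoidHom (ℝˣ × ℝˣ) ℝ).comp _ monomialChar_injective
  have hsum (M : ℤ × ℤ →₀ ℤ) (hM : IsRefinedFamily b M) (A z : ℝˣ) (q : ℝ) (hq : 0 < q)
      (hq1 : q ≠ 1) (hz : q - q⁻¹ = z) :
      Finsupp.linearCombination ℝ ((fun f : ℝˣ × ℝˣ →* ℝ => (f : ℝˣ × ℝˣ → ℝ)) ∘ monomialChar)
        (M.mapRange (Int.cast : ℤ → ℝ) Int.cast_zero) (A, z) =
          reformulated b q A hq A.ne_zero := by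
    rw [hM q A hq A.ne_zero hq1, Finsupp.linearCombination_apply,
      Finsupp.sum_mapRange_index (by simp), Finsupp.sum, Finsupp.sum, Finset.sum_apply]
    refine Finset.sum_congr rfl fun p _ => ?_
    simp [monomialChar_apply, cBox_eq_one hq hq1, hz, mul_assoc]
  have key := hli (a₁ := N.mapRange (Int.cast : ℤ → ℝ) Int.cast_zero)
    (a₂ := N'.mapRange (Int.cast : ℤ → ℝ) Int.cast_zero) (by
      funext x
      obtain ⟨q, hq, hq1, hz⟩ := exists_sub_inv_eq x.2.ne_zero
      exact (hsum N h x.1 x.2 q hq hq1 hz).trans (hsum N' h' x.1 x.2 q hq hq1 hz).symm)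
  exact Finsupp.mapRange_injective _ Int.cast_zero Int.cast_injective key

/-! ### Existence of the refined family -/

/-- The family `N (j, i - 1) = coeff p i`, which represents
`A ^ j * (q - q⁻¹) ^ (-3) * p ((q - q⁻¹) ^ 2)`. -/
noncomputable def row (j : ℤ) (p : ℤ[X]) : ℤ × ℤ →₀ ℤ :=
  p.sum fun i c => Finsupp.single (j, (i : ℤ) - 1) c

theorem row_apply_sub_one (j : ℤ) (p : ℤ[X]) (i : ℕ) : row j p (j, (i : ℤ) - 1) = p.coeff i := by
  rw [row, Polynomial.sum, Finsupp.finsetSum_apply, Finset.sum_eq_single i]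
  · simp
  · intro i' _ hne
    exact Finsupp.single_eq_of_ne (by simpa using hne.symm)
  · intro hi
    simp [notMem_support_iff.1 hi]

theorem row_apply_of_ne {j m : ℤ} (hm : m ≠ j) (p : ℤ[X]) (k : ℤ) : row j p (m, k) = 0 := by
  rw [row, Polynomial.sum, Finsupp.finsetSum_apply]
  exact Finset.sum_eq_zero fun i _ => Finsupp.single_eq_of_ne (by simp [hm])

theorem row_apply_of_neg (j m : ℤ) {p : ℤ[X]} (hp : p.coeff 0 = 0) {k : ℤ} (hk : k < 0) :
    row j p (m, k) = 0 := by
  rw [row, Polynomial.sum, Finsupp.finsetSum_apply]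
  refine Finset.sum_eq_zero fun i hi => Finsupp.single_eq_of_ne fun h => ?_
  have hi0 : i = 0 := by
    have := congrArg Prod.snd h
    simp only at this
    omega
  exact mem_support_iff.1 hi (hi0 ▸ hp)

/-- The Laurent polynomial represented by a family of refined integers. -/
noncomputable def refinedEval (q A : ℝ) (N : ℤ × ℤ →₀ ℤ) : ℝ :=
  N.sum fun p c => cBox q * (c : ℝ) * A ^ p.1 * (q - q⁻¹) ^ (2 * p.2 - 1)

theorem refinedEval_add (q A : ℝ) (N N' : ℤ × ℤ →₀ ℤ) :
    refinedEval q A (N + N') = refinedEval q A N + refinedEval q A N' :=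
  Finsupp.sum_add_index' (by simp) (by intros; push_cast; ring)

theorem refinedEval_row {q : ℝ} (hq : 0 < q) (hq1 : q ≠ 1) (A : ℝ) (j : ℤ) (p : ℤ[X]) :
    refinedEval q A (row j p) = (q - q⁻¹) ^ (-3 : ℤ) * (aeval ((q - q⁻¹) ^ 2) p * A ^ j) := by
  have hz := sub_inv_ne_zero hq hq1
  rw [refinedEval, row, Polynomial.sum, ← Finsupp.sum_finsetSum_index (by simp)
    (by intros; push_cast; ring), aeval_def, eval₂_eq_sum,
    Polynomial.sum, Finset.sum_mul, Finset.mul_sum]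
  refine Finset.sum_congr rfl fun i _ => ?_
  rw [Finsupp.sum_single_index (by simp), cBox_eq_one hq hq1,
    show (2 * ((i : ℤ) - 1) - 1) = -3 + ((2 * i : ℕ) : ℤ) by push_cast; ring, zpow_add₀ hz,
    zpow_natCast, pow_mul, eq_intCast]
  ring

/-- The mirror image of a family of refined integers. -/
noncomputable def mirror (N : ℤ × ℤ →₀ ℤ) : ℤ × ℤ →₀ ℤ :=
  -N.embDomain ((Equiv.neg ℤ).prodCongr (Equiv.refl ℤ)).toEmbedding

theorem mirror_apply (N : ℤ × ℤ →₀ ℤ) (m k : ℤ) : mirror N (m, k) = -N (-m, k) := by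
  rw [mirror, Finsupp.neg_apply]
  congr 1
  have := Finsupp.embDomain_apply_self ((Equiv.neg ℤ).prodCongr (Equiv.refl ℤ)).toEmbedding N (-m, k)
  simpa using this

/-- Inverting `q` negates `z`, whose exponent `2k - 1` is odd; hence the sign in `mirror`. -/
theorem refinedEval_mirror {q : ℝ} (hq : 0 < q) (hq1 : q ≠ 1) (A : ℝ) (N : ℤ × ℤ →₀ ℤ) :
    refinedEval q A (mirror N) = refinedEval q⁻¹ A⁻¹ N := by
  rw [refinedEval, mirror, Finsupp.sum_neg_index (by simp), Finsupp.sum_embDomain, refinedEval]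
  refine Finset.sum_congr rfl fun p _ => ?_
  have hodd : Odd (2 * p.2 - 1) := ⟨p.2 - 1, by ring⟩
  have hz : (q⁻¹ - q⁻¹⁻¹) ^ (2 * p.2 - 1) = -(q - q⁻¹) ^ (2 * p.2 - 1) := by
    rw [← hodd.neg_zpow, inv_inv, neg_sub]
  dsimp only
  rw [hz, cBox_eq_one hq hq1, cBox_eq_one (inv_pos.2 hq) (by simpa using hq1)]
  simp

/-- This makes the coefficients of `A⁹` and `A³` integral despite the denominator `[3]_q`. -/
theorem exists_quotient_tracePoly (n : ℕ) : ∃ p : ℤ[X], (X + 3) * p = X + 1 + tracePoly n := by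
  have h : (X + 1 + tracePoly n).IsRoot (-3) := by
    simp [IsRoot, eval_tracePoly_neg_three]
  obtain ⟨p, hp⟩ := dvd_iff_isRoot.2 h
  exact ⟨p, by rw [hp]; simp⟩

/-- The refined family for the negative full twist, with `p` the quotient of
`[3]_q - 2 + tracePoly n` by `[3]_q`. -/
noncomputable def refinedFamily (n : ℕ) (p : ℤ[X]) : ℤ × ℤ →₀ ℤ :=
  row 9 p + row 7 (-(tracePoly n + (1 + 3 * X + X ^ 2))) +
    row 5 (tracePoly n + (1 + 6 * X + 5 * X ^ 2 + X ^ 3)) + row 3 (-(p + (3 * X + 4 * X ^ 2 + X ^ 3)))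

variable {n : ℕ} {p : ℤ[X]}

theorem isRefinedFamily_refinedFamily (hp : (X + 3) * p = X + 1 + tracePoly n) :
    IsRefinedFamily (Qhat 1 1 n (-1)) (refinedFamily n p) := by
  intro q A hq hA hq1
  have ha := congrArg (aeval ((q - q⁻¹) ^ 2)) hp
  simp only [map_mul, map_add, aeval_X, map_one, map_ofNat] at ha
  change _ = refinedEval q A _
  rw [reformulated, homflyStar_Qhat_neg_one hq hA hq1 n rfl ha, refinedFamily]
  simp only [refinedEval_add, refinedEval_row hq hq1, map_neg, map_add, map_mul, map_pow, aeval_X,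
    map_one, map_ofNat, zpow_ofNat]
  ring

theorem isRefinedFamily_mirror (hp : (X + 3) * p = X + 1 + tracePoly n) :
    IsRefinedFamily (Qhat 1 1 n 1) (mirror (refinedFamily n p)) := by
  intro q A hq hA hq1
  change _ = refinedEval q A _
  rw [refinedEval_mirror hq hq1, reformulated]
  have h := homflyStar_Qhat_neg hq hA n (-1)
  rw [neg_neg] at h
  exact h.trans
    (isRefinedFamily_refinedFamily hp q⁻¹ A⁻¹ (inv_pos.2 hq) (inv_ne_zero hA) (by simpa using hq1))

/-- A negative `k` can only be `-1`, from the constant terms of the four rows; these vanish because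
`V(0) = -1`. -/
theorem refinedFamily_of_neg (hp : (X + 3) * p = X + 1 + tracePoly n) (hn : ¬ 3 ∣ n) (m : ℤ)
    {k : ℤ} (hk : k < 0) : refinedFamily n p (m, k) = 0 := by
  have hV : (tracePoly n).coeff 0 = -1 := by
    rw [coeff_zero_eq_eval_zero, eval_tracePoly_zero hn]
  have hp0 : p.coeff 0 = 0 := by
    have := congrArg (eval 0) hp
    rw [coeff_zero_eq_eval_zero] at hV ⊢
    simpa [hV] using this
  simp only [refinedFamily, Finsupp.add_apply]
  rw [row_apply_of_neg _ _ hp0 hk, row_apply_of_neg _ _ _ hk, row_apply_of_neg _ _ _ hk,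
    row_apply_of_neg _ _ _ hk]
  · rfl
  · simp [hp0]
  · simp [hV]
  · simp [hV]

theorem refinedFamily_five {k : ℕ} (hk : k ≤ n) :
    (refinedFamily n p (5, (k : ℤ) - 1) : ℝ) = G n k := by
  have h : refinedFamily n p (5, (k : ℤ) - 1) =
      (tracePoly n + (1 + 6 * X + 5 * X ^ 2 + X ^ 3)).coeff k := by
    simp only [refinedFamily, Finsupp.add_apply, row_apply_sub_one]
    rw [row_apply_of_ne (by norm_num), row_apply_of_ne (by norm_num), row_apply_of_ne (by norm_num)]
    ring
  rw [h, G, coeff_add, Int.cast_add, coeff_tracePoly hk, ← map_ofNat C 6, ← map_ofNat C 5]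
  simp [coeff_one, coeff_X, coeff_X_pow, delta, eq_comm]

theorem refinedFamily_seven (hn : n ≠ 0) {k : ℕ} (hk : k ≤ n) :
    (refinedFamily n p (7, (k : ℤ) - 1) : ℝ) = F n k := by
  have h : refinedFamily n p (7, (k : ℤ) - 1) =
      (-(tracePoly n + (1 + 3 * X + X ^ 2))).coeff k := by
    simp only [refinedFamily, Finsupp.add_apply, row_apply_sub_one]
    rw [row_apply_of_ne (by norm_num), row_apply_of_ne (by norm_num), row_apply_of_ne (by norm_num)]
    ring
  -- The exponent `n - 1` in `F` is a truncated subtraction, so `(-1)^(n-1) = -(-1)^n` needs `n ≠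
  -- 0`.
  obtain ⟨m, rfl⟩ := Nat.exists_eq_succ_of_ne_zero hn
  rw [h, F, coeff_neg, coeff_add, Int.cast_neg, Int.cast_add, coeff_tracePoly hk, ← map_ofNat C 3,
    pow_succ (-1 : ℝ)]
  simp [coeff_one, coeff_X, coeff_X_pow, delta, eq_comm]
  ring

end HybridWeaving

theorem proposition4 (n : ℕ) (hn : 4 ≤ n) :
    (∃! N : ℤ × ℤ →₀ ℤ, HybridWeaving.IsRefinedFamily (HybridWeaving.Qhat 1 1 n (-1)) N) ∧
    (∃! N : ℤ × ℤ →₀ ℤ, HybridWeaving.IsRefinedFamily (HybridWeaving.Qhat 1 1 n 1) N) ∧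
    ∀ Nminus Nplus : ℤ × ℤ →₀ ℤ,
      HybridWeaving.IsRefinedFamily (HybridWeaving.Qhat 1 1 n (-1)) Nminus →
      HybridWeaving.IsRefinedFamily (HybridWeaving.Qhat 1 1 n 1) Nplus →
      (¬ 3 ∣ n → ∀ m k : ℤ, k < 0 → Nminus (m, k) = 0 ∧ Nplus (m, k) = 0) ∧
      ∀ k : ℕ, k ≤ n →
        (Nminus (5, (k : ℤ) - 1) : ℝ) = HybridWeaving.G n k ∧
        (Nminus (7, (k : ℤ) - 1) : ℝ) = HybridWeaving.F n k ∧
        (Nplus (-5, (k : ℤ) - 1) : ℝ) = -HybridWeaving.G n k ∧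
        (Nplus (-7, (k : ℤ) - 1) : ℝ) = -HybridWeaving.F n k := by
  obtain ⟨p, hp⟩ := HybridWeaving.exists_quotient_tracePoly n
  have hm := HybridWeaving.isRefinedFamily_refinedFamily hp
  have hpl := HybridWeaving.isRefinedFamily_mirror hp
  refine ⟨⟨_, hm, fun _ h => h.unique hm⟩, ⟨_, hpl, fun _ h => h.unique hpl⟩, ?_⟩
  intro Nminus Nplus h1 h2
  obtain rfl := h1.unique hm
  obtain rfl := h2.unique hpl
  refine ⟨fun h3 m k hk => ⟨HybridWeaving.refinedFamily_of_neg hp h3 m hk, ?_⟩, fun k hk => ?_⟩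
  · rw [HybridWeaving.mirror_apply, HybridWeaving.refinedFamily_of_neg hp h3 _ hk, neg_zero]
  · have h5 := HybridWeaving.refinedFamily_five (p := p) hk
    have h7 := HybridWeaving.refinedFamily_seven (p := p) (by omega) hk
    refine ⟨h5, h7, ?_, ?_⟩
    · rw [HybridWeaving.mirror_apply, neg_neg, Int.cast_neg, h5]
    · rw [HybridWeaving.mirror_apply, neg_neg, Int.cast_neg, h7]
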